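/- Let $\mathbf F_q$ be a finite field with $q$ elements, let $\pi\in\mathbf F_q[x]$ be a monic irreducible polynomial of degree $\delta$, let $K_\pi$ be the completion of $\mathbf F_q(x)$ with respect to the $\pi$-adic absolute value normalized by $|\pi|_\pi=q^{-\delta}$, let $O_\pi=\{t\in K_\pi:\ |t|_\pi\le 1\}$, and let $\Omega_\pi$ be the completion of an algebraic closure of $K_\pi$ with respect to the canonical extension of $|\cdot|_\pi$. For functions $u:O_\pi\to\Omega_\pi$ put $(\Delta u)(t)=u(xt)-xu(t)$, $\tau u=u^q$, $du=\sqrt[q]{\Delta u}$. Put $[j]=x^{q^j}-x$, $D_i=\prod_{j=1}^{i}[j]^{q^{i-j}}$, $L_i=\prod_{j=1}^{i}[j]$, and let $$f_i(t)=D_i^{-1}\prod_{\omega\in\mathbf F_q[x],\ \deg\omega<i}(t-\omega),\qquad i\ge 0,$$ be the normalized Carlitz polynomials (so $f_0(t)=t$). Let $l_1:O_\pi\to\Omega_\pi$ be any continuous $\mathbf F_q$-linear solution of $(1-\tau)du(t)=t$, $t\in O_\pi$, such that $l_1(t)=\sum_{j\ge1}t^{q^j}/[j]$ for $|t|_\pi\le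 q^{-\delta}$. Then there are continuous $\mathbf F_q$-linear functions $l_n:O_\pi\to\Omega_\pi$, $n\ge 2$, such that for each $n\ge2$ the function $l_n$ is the unique continuous $\mathbf F_q$-linear solution on $O_\pi$ of the equation $$\Delta l_n=l_{n-1}$$ that satisfies $$l_n(t)=\sum_{j=1}^\infty\frac{t^{q^j}}{[j]^n}\qquad\text{for } |t|_\pi\le q^{-\delta}.$$ Moreover, for each $n\ge2$ this solution has an expansion $l_n=\sum_{i=0}^\infty c_i^{(n)}f_i$ with $c_i^{(n)}\in\Omega_\pi$, uniformly convergent on $O_\pi$, where, for some constant $C_n>0$, $$|c_i^{(n)}|_\pi\le C_n\,q^{-\delta q^{\,i-\delta}}\quad\text{for all } i>\delta,\qquad\text{and}\qquad c_0^{(n)}=\sum_{i=1}^\infty(-1)^{i+1}\frac{c_i^{(n)}}{L_i},$$ the last series being convergent. -/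

import Mathlib

open Polynomial Filter Topology
open scoped NNReal

noncomputable section

/-- A finite place of the rational function field `F(x)`: a monic irreducible polynomial `π`. -/
structure FinPlace (F : Type*) [Field F] where
  /-- the polynomial `π` -/
  poly : F[X]
  monic : poly.Monic
  irreducible : Irreducible poly

namespace FinPlace

variable {F : Type*} [Field F] [Fintype F] (P : FinPlace F)

/-- The cardinality `q` of the field of constants. -/
abbrev q (_ : FinPlace F) : ℕ := Fintype.card F

/-- The degree `δ` of `π`. -/
abbrev δ : ℕ := P.poly.natDegree

/-- The prime ideal of `F[x]` generated by `π`. -/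
def heightOne : IsDedekindDomain.HeightOneSpectrum F[X] where
  asIdeal := Ideal.span {P.poly}
  isPrime := (Ideal.span_singleton_prime P.irreducible.ne_zero).2 P.irreducible.prime
  ne_bot := by simpa using P.irreducible.ne_zero

lemma one_lt_q_pow : (1 : ℝ≥0) < (P.q : ℝ≥0) ^ P.δ :=
  one_lt_pow₀ (by exact_mod_cast Fintype.one_lt_card) P.irreducible.natDegree_pos.ne'

/-- The absolute value `|·|_π` on `F(x)`: `|π^m α/α'| = (q^δ)^(-m)` if `π ∤ α, α'`. -/
def absVal : AbsoluteValue (RatFunc F) ℝ :=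
  P.heightOne.adicAbv P.one_lt_q_pow

/-- Normalization: `|π|_π = q^(-δ)`. -/
lemma absVal_poly : P.absVal (algebraMap F[X] (RatFunc F) P.poly) = ((P.q : ℝ) ^ P.δ)⁻¹ := by
  have h := P.heightOne.intValuation_singleton P.irreducible.ne_zero rfl
  rw [absVal, IsDedekindDomain.HeightOneSpectrum.adicAbv_of_algebraMap]
  simp only [IsDedekindDomain.HeightOneSpectrum.intAdicAbv,
    IsDedekindDomain.HeightOneSpectrum.intAdicAbvDef]
  change ((WithZeroMulInt.toNNReal _ (P.heightOne.intValuation P.poly) : ℝ≥0) : ℝ) = _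
  rw [h, WithZeroMulInt.toNNReal_neg_apply _ WithZero.exp_ne_zero]
  change (((P.q : ℝ≥0) ^ P.δ) ^ (-1 : ℤ) : ℝ≥0).toReal = _
  simp

/-- `K_π`: the completion of `F(x)` with respect to `|·|_π`. -/
abbrev K : Type _ := P.absVal.Completion

lemma norm_coe (r : RatFunc F) : ‖algebraMap (RatFunc F) P.K r‖ = P.absVal r :=
  UniformSpace.Completion.norm_coe _

instance : IsUltrametricDist (WithAbs P.absVal) :=
  IsUltrametricDist.isUltrametricDist_of_forall_norm_add_le_max_norm fun x y =>
    P.heightOne.isNonarchimedean_adicAbv P.one_lt_q_pow x.ofAbs y.ofAbs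

instance : IsUltrametricDist P.K :=
  IsUltrametricDist.of_normedAlgebra (WithAbs P.absVal)

instance : NontriviallyNormedField P.K where
  non_trivial := by
    refine ⟨algebraMap (RatFunc F) P.K (algebraMap F[X] (RatFunc F) P.poly)⁻¹, ?_⟩
    rw [norm_coe, map_inv₀, absVal_poly, inv_inv]
    exact_mod_cast P.one_lt_q_pow

/-- An algebraic closure of `K_π`. -/
abbrev KAlg : Type _ := AlgebraicClosure P.K

/-- The canonical extension of `|·|_π` to the algebraic closure of `K_π`. -/
instance : NormedField P.KAlg := spectralNorm.normedField P.K P.KAlg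

instance : NormedAlgebra P.K P.KAlg := spectralNorm.normedAlgebra P.K P.KAlg

/-- `Ω_π`: the completion of the algebraic closure of `K_π`. -/
abbrev Ω : Type _ := UniformSpace.Completion P.KAlg

instance : UniformContinuousConstSMul F P.KAlg where
  uniformContinuous_const_smul r := by
    simp_rw [Algebra.smul_def]
    exact (Ring.uniformContinuousConstSMul _).uniformContinuous_const_smul _

lemma norm_Ω (t : P.K) : ‖algebraMap P.K P.Ω t‖ = ‖t‖ := norm_algebraMap' P.Ω t

/-- The element `x` of `K_π`. -/
def x : P.K := algebraMap (RatFunc F) P.K RatFunc.X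

lemma norm_algebraMap_poly_le (p : F[X]) : ‖algebraMap F[X] P.K p‖ ≤ 1 := by
  have : algebraMap F[X] P.K p = algebraMap (RatFunc F) P.K (algebraMap F[X] (RatFunc F) p) :=
    rfl
  rw [this, norm_coe]
  exact P.heightOne.adicAbv_coe_le_one P.one_lt_q_pow p

/-- `O_π = {t ∈ K_π : |t|_π ≤ 1}`, as an algebra over the field of constants. -/
def O : Subalgebra F P.K where
  carrier := {t | ‖t‖ ≤ 1}
  mul_mem' {a b} ha hb := by
    simpa using mul_le_one₀ ha (norm_nonneg _) hb
  add_mem' {a b} ha hb :=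
    (IsUltrametricDist.norm_add_le_max a b).trans (max_le ha hb)
  algebraMap_mem' r := by
    exact P.norm_algebraMap_poly_le (C r)

/-- The element `x` of `O_π`. -/
def xO : P.O :=
  ⟨P.x, by
    have h : P.x = algebraMap F[X] P.K X := by rw [x, ← RatFunc.algebraMap_X]; rfl
    rw [h]; exact P.norm_algebraMap_poly_le X⟩

/-- `[n] = x^(q^n) - x`. -/
def brk (n : ℕ) : P.K := P.x ^ P.q ^ n - P.x

/-- `D_i = [i] [i-1]^q ⋯ [1]^(q^(i-1))`, with `D_0 = 1`. -/
def D (i : ℕ) : P.K := ∏ j ∈ Finset.Icc 1 i, P.brk j ^ P.q ^ (i - j)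

/-- `L_i = [i] [i-1] ⋯ [1]`, with `L_0 = 1`. -/
def L (i : ℕ) : P.K := ∏ j ∈ Finset.Icc 1 i, P.brk j

lemma finite_degree_lt (i : ℕ) : {ω : F[X] | ω.degree < i}.Finite := by
  have h : Finite (degreeLT F i) := Finite.of_equiv _ (degreeLTEquiv F i).toEquiv.symm
  refine (Set.toFinite (degreeLT F i : Set F[X])).subset fun ω hω => ?_
  exact mem_degreeLT.2 hω

/-- The Carlitz polynomial `e_i(t) = ∏_{deg ω < i} (t - ω)`; in particular `e_0(t) = t`. -/
def e (i : ℕ) (t : P.K) : P.K :=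
  ∏ ω ∈ (finite_degree_lt (F := F) i).toFinset, (t - algebraMap F[X] P.K ω)

/-- The normalized Carlitz polynomial `f_i = e_i / D_i`. -/
def f (i : ℕ) (t : P.K) : P.K := P.e i t / P.D i

/-- Carlitz's difference operator `(Δu)(t) = u(xt) - x u(t)` on functions `O_π → Ω_π`. -/
def carlitzDelta (u : P.O → P.Ω) (t : P.O) : P.Ω :=
  u (P.xO * t) - algebraMap P.K P.Ω P.x * u t

/-- `w = du`, where `d` is the `q`-th root of `Δ` (`q`-th roots are unique in `Ω_π`). -/
def IsCarlitzDerivative (u w : P.O → P.Ω) : Prop :=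
  ∀ t, w t ^ P.q = P.carlitzDelta u t

/-- `u` satisfies the equation `(1 - τ) du(t) = t` on `O_π`, where `τ w = w^q`. -/
def SolvesLogEquation (u : P.O → P.Ω) : Prop :=
  ∃ w : P.O → P.Ω, P.IsCarlitzDerivative u w ∧
    ∀ t : P.O, w t - w t ^ P.q = algebraMap P.K P.Ω t

/-- `u(t) = ∑_{j ≥ 1} t^(q^j) / [j]^n` for all `t` with `|t|_π ≤ q^(-δ)`. -/
def AgreesWithPolylogSeries (n : ℕ) (u : P.O → P.Ω) : Prop :=
  ∀ t : P.O, ‖(t : P.K)‖ ≤ ((P.q : ℝ) ^ P.δ)⁻¹ →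
    HasSum (fun j : ℕ => algebraMap P.K P.Ω ((t : P.K) ^ P.q ^ (j + 1) / P.brk (j + 1) ^ n)) (u t)

/-- `u = ∑_{i ≥ 0} c_i f_i`, with uniform convergence on `O_π`. -/
def HasCarlitzExpansion (u : P.O → P.Ω) (c : ℕ → P.Ω) : Prop :=
  TendstoUniformly
    (fun (N : ℕ) (t : P.O) => ∑ i ∈ Finset.range N, c i * algebraMap P.K P.Ω (P.f i t)) u atTop

end FinPlace

end

noncomputable section

/-! Let K_π[X] act on functions O_π → Ω_π, with X acting as u(t) ↦ u(xt) (`act`); then Δ is X - x.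
On F-linear functions π(X) acts as u(t) ↦ u(πt) (`act_map`). Dividing π(X) = (X - x)·`quot` + π
gives u(πt) = (`quot`·Δu)(t) + π u(t) (`apply_poly_mul`), so u is determined by Δu and by its values
on πO_π, which is the disc |t| ≤ q^(-δ). Solving for u yields uniqueness, existence (`integral`) and
boundedness of the l_n.

The i-th Carlitz coefficient of u is (N_i u)(1), where N_i = `newton i` is the Newton polynomial
with nodes x^(q^j), because X^k = ∑ f_i(x^k) N_i (`X_pow_eq_sum_newton`). Modulo π^(q^i) the last δ
factors of N_(i+δ) multiply to π(X), since π(x^(q^j)) = π^(q^j). Hence N_(i+δ) u is N_i applied to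
the polylogarithm series, up to an error of order |π|^(q^i). As t^(q^j) is an eigenfunction of X
with eigenvalue x^(q^j), N_i kills the terms with j < i, and the others are themselves of order
|π|^(q^i). This is the decay (`exists_norm_coef_add_le`).

Finally Δl_(n+1) = l_n translates into c_i^(n) = c_(i+1)^(n+1) + [i] c_i^(n+1)
(`coef_carlitzDelta`), and the series for c_0^(n) telescopes (`sum_range_coef_div_L`). -/

/-! ### Products over the field of constants -/

lemma FiniteField.prod_X_sub_C_eq (F : Type*) [Field F] [Fintype F] :
    ∏ a : F, (X - C a) = (X ^ Fintype.card F - X : F[X]) := by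
  have h := FiniteField.roots_X_pow_card_sub_X F
  have hm : (X ^ Fintype.card F - X : F[X]).Monic :=
    monic_X_pow_sub (n := Fintype.card F) (by
      rw [degree_X]; exact_mod_cast Fintype.one_lt_card)
  have := prod_multiset_X_sub_C_of_monic_of_roots_card_eq hm (by
    rw [h, FiniteField.X_pow_card_sub_X_natDegree_eq _ Fintype.one_lt_card]; rfl)
  rw [← this, h]
  rfl

/-- Homogeneous form of ∏ (X - a) = X^q - X; it produces the recursion for e_i. -/
lemma FiniteField.prod_sub_algebraMap_mul (F : Type*) [Field F] [Fintype F] {K : Type*} [Field K]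
    [Algebra F K] (y z : K) :
    ∏ a : F, (y - algebraMap F K a * z) =
      y ^ Fintype.card F - z ^ (Fintype.card F - 1) * y := by
  have hq : Fintype.card F - 1 ≠ 0 := (Nat.sub_pos_of_lt Fintype.one_lt_card).ne'
  have hq' : Fintype.card F - 1 + 1 = Fintype.card F := Nat.sub_add_cancel Fintype.card_pos
  rcases eq_or_ne z 0 with rfl | hz
  · simp [hq]
  have h := congrArg (aeval (y / z)) (FiniteField.prod_X_sub_C_eq F)
  simp only [map_prod, map_sub, aeval_X, aeval_C, map_pow] at h
  calc _ = ∏ a : F, (z * (y / z - algebraMap F K a)) := by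
        refine Finset.prod_congr rfl fun a _ => ?_
        rw [mul_sub, mul_div_cancel₀ _ hz, mul_comm]
    _ = z ^ Fintype.card F * ((y / z) ^ Fintype.card F - y / z) := by
        rw [Finset.prod_mul_distrib, h, Finset.prod_const, Finset.card_univ]
    _ = _ := by
        rw [mul_sub, ← mul_pow, mul_div_cancel₀ _ hz]
        nth_rewrite 2 [← hq']
        rw [pow_succ, mul_assoc, mul_div_cancel₀ _ hz]

namespace FinPlace

variable {F : Type*} [Field F] [Fintype F] (P : FinPlace F)

/-! ### Absolute values of the brackets; density of polynomials in O_π -/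

/-- The real number `q^(-δ) = |π|_π`. -/
def r : ℝ := ((P.q : ℝ) ^ P.δ)⁻¹

lemma one_lt_q_pow_real : (1 : ℝ) < (P.q : ℝ) ^ P.δ := by exact_mod_cast P.one_lt_q_pow

lemma r_pos : 0 < P.r := inv_pos.2 (zero_lt_one.trans P.one_lt_q_pow_real)

lemma r_lt_one : P.r < 1 := inv_lt_one_of_one_lt₀ P.one_lt_q_pow_real

lemma one_lt_q : 1 < P.q := Fintype.one_lt_card

lemma algebraMap_eq_coe (p : F[X]) :
    algebraMap F[X] P.K p = algebraMap (RatFunc F) P.K (algebraMap F[X] (RatFunc F) p) := rfl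

lemma norm_algebraMap_poly : ‖algebraMap F[X] P.K P.poly‖ = P.r := by
  rw [algebraMap_eq_coe, norm_coe, absVal_poly, r]

lemma absVal_eq_one {p : F[X]} (h : ¬ P.poly ∣ p) :
    P.absVal (algebraMap F[X] (RatFunc F) p) = 1 := by
  rw [absVal, IsDedekindDomain.HeightOneSpectrum.adicAbv_coe_eq_one_iff]
  change p ∉ Ideal.span {P.poly}
  rwa [Ideal.mem_span_singleton]

lemma norm_algebraMap_eq_one {p : F[X]} (h : ¬ P.poly ∣ p) : ‖algebraMap F[X] P.K p‖ = 1 := by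
  rw [algebraMap_eq_coe, norm_coe, P.absVal_eq_one h]

lemma absVal_lt_one {p : F[X]} (h : P.poly ∣ p) :
    P.absVal (algebraMap F[X] (RatFunc F) p) < 1 := by
  rw [absVal, IsDedekindDomain.HeightOneSpectrum.adicAbv_coe_lt_one_iff]
  change p ∈ Ideal.span {P.poly}
  rwa [Ideal.mem_span_singleton]

lemma x_eq : P.x = algebraMap F[X] P.K X := by rw [x, ← RatFunc.algebraMap_X]; rfl

lemma norm_x_le : ‖P.x‖ ≤ 1 := P.xO.2

lemma brk_eq (n : ℕ) : P.brk n = algebraMap F[X] P.K (X ^ P.q ^ n - X) := by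
  rw [brk, x_eq, map_sub, map_pow]

lemma norm_brk_eq_one {n : ℕ} (h : ¬ P.δ ∣ n) : ‖P.brk n‖ = 1 := by
  rw [brk_eq]
  refine P.norm_algebraMap_eq_one fun hd => h ?_
  exact P.irreducible.natDegree_dvd_of_dvd_X_pow_card_pow_sub_X
    (by rwa [Nat.card_eq_fintype_card])

/-- The derivative of X^(q^n) - X is -1, so this polynomial is squarefree. -/
lemma not_sq_dvd {n : ℕ} (hn : n ≠ 0) : ¬ P.poly * P.poly ∣ X ^ P.q ^ n - X := by
  intro h
  have h1 : P.poly ∣ derivative (X ^ P.q ^ n - X : F[X]) := by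
    obtain ⟨g, hg⟩ := h
    rw [hg]
    simp only [derivative_mul]
    exact ⟨derivative P.poly * g + derivative P.poly * g + P.poly * derivative g, by ring⟩
  have h2 : derivative (X ^ P.q ^ n - X : F[X]) = -1 := by
    simp [derivative_X_pow, hn, q]
  rw [h2, dvd_neg] at h1
  exact P.irreducible.not_isUnit (isUnit_of_dvd_one h1)

lemma le_norm_brk {n : ℕ} (hn : n ≠ 0) : P.r ≤ ‖P.brk n‖ := by
  rw [brk_eq]
  by_cases h : P.poly ∣ X ^ P.q ^ n - X
  · obtain ⟨g, hg⟩ := h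
    have hg' : ¬ P.poly ∣ g := by
      rintro ⟨k, rfl⟩
      exact P.not_sq_dvd hn ⟨k, by rw [hg, mul_assoc]⟩
    rw [hg, map_mul, norm_mul, norm_algebraMap_poly, P.norm_algebraMap_eq_one hg', mul_one]
  · rw [P.norm_algebraMap_eq_one h]; exact P.r_lt_one.le

lemma brk_ne_zero {n : ℕ} (hn : n ≠ 0) : P.brk n ≠ 0 :=
  norm_pos_iff.1 (P.r_pos.trans_le (P.le_norm_brk hn))

/-- A rational function of absolute value at most one is approximated by polynomials. -/
lemma exists_poly_absVal_lt (s : RatFunc F) (hs : P.absVal s ≤ 1) {ε : ℝ} (hε : 0 < ε) :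
    ∃ p : F[X], P.absVal (s - algebraMap F[X] (RatFunc F) p) < ε := by
  obtain ⟨m, hm⟩ := exists_pow_lt_of_lt_one hε P.r_lt_one
  have hd : ¬ P.poly ∣ s.denom := by
    intro hd
    have hn : ¬ P.poly ∣ s.num := fun hn =>
      P.irreducible.not_isUnit (s.isCoprime_num_denom.isUnit_of_dvd' hn hd)
    have h1 := P.absVal_eq_one hn
    have h2 := P.absVal_lt_one hd
    rw [← s.num_div_denom, map_div₀, h1, one_div] at hs
    have h0 : 0 < P.absVal (algebraMap F[X] (RatFunc F) s.denom) :=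
      P.absVal.pos (RatFunc.algebraMap_ne_zero s.denom_ne_zero)
    exact absurd hs (not_le.2 ((one_lt_inv₀ h0).2 h2))
  -- Here `a` inverts the denominator modulo π^m.
  obtain ⟨a, b, hab⟩ : IsCoprime s.denom (P.poly ^ m) :=
    ((P.irreducible.coprime_iff_not_dvd.2 hd).symm).pow_right
  refine ⟨s.num * a, ?_⟩
  have hd0 : algebraMap F[X] (RatFunc F) s.denom ≠ 0 :=
    RatFunc.algebraMap_ne_zero s.denom_ne_zero
  have key : s - algebraMap F[X] (RatFunc F) (s.num * a) =
      algebraMap F[X] (RatFunc F) (s.num * b) * algebraMap F[X] (RatFunc F) P.poly ^ m /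
        algebraMap F[X] (RatFunc F) s.denom := by
    have hab' := congrArg (algebraMap F[X] (RatFunc F)) hab
    simp only [map_add, map_mul, map_pow, map_one] at hab'
    nth_rewrite 1 [← s.num_div_denom]
    rw [eq_div_iff hd0, sub_mul, div_mul_cancel₀ _ hd0, map_mul, map_mul]
    linear_combination (-algebraMap F[X] (RatFunc F) s.num) * hab'
  rw [key, map_div₀, P.absVal_eq_one hd, div_one, map_mul, map_pow, absVal_poly]
  calc _ ≤ 1 * P.r ^ m := by
        refine mul_le_mul_of_nonneg_right ?_ (pow_nonneg P.r_pos.le _)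
        exact P.heightOne.adicAbv_coe_le_one P.one_lt_q_pow _
    _ < ε := by rwa [one_mul]

/-- The image of a polynomial in `O_π`. -/
def polyO (p : F[X]) : P.O := ⟨algebraMap F[X] P.K p, P.norm_algebraMap_poly_le p⟩

@[simp] lemma coe_polyO (p : F[X]) : (P.polyO p : P.K) = algebraMap F[X] P.K p := rfl

@[simp] lemma coe_xO : (P.xO : P.K) = P.x := rfl

lemma exists_poly_norm_lt (t : P.O) {ε : ℝ} (hε : 0 < ε) :
    ∃ p : F[X], ‖(t : P.K) - algebraMap F[X] P.K p‖ < ε := by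
  obtain ⟨s, hs⟩ := Metric.denseRange_iff.1
    (UniformSpace.Completion.denseRange_coe (α := WithAbs P.absVal)) (t : P.K) (min ε 1)
    (lt_min hε one_pos)
  rw [dist_eq_norm] at hs
  have hc : ((s : WithAbs P.absVal) : P.K) = algebraMap (RatFunc F) P.K s.ofAbs := rfl
  rw [hc] at hs
  have h1 : P.absVal s.ofAbs ≤ 1 := by
    rw [← norm_coe]
    have := IsUltrametricDist.norm_add_le_max (t : P.K)
      (-((t : P.K) - algebraMap (RatFunc F) P.K s.ofAbs))
    rw [← sub_eq_add_neg, sub_sub_cancel, norm_neg] at this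
    exact this.trans (max_le t.2 (hs.le.trans (min_le_right _ _)))
  obtain ⟨p, hp⟩ := P.exists_poly_absVal_lt s.ofAbs h1 hε
  refine ⟨p, ?_⟩
  rw [← norm_coe, map_sub] at hp
  rw [← sub_add_sub_cancel _ (algebraMap (RatFunc F) P.K s.ofAbs)]
  exact (IsUltrametricDist.norm_add_le_max _ _).trans_lt
    (max_lt (hs.trans_le (min_le_left _ _)) hp)

lemma denseRange_polyO : DenseRange P.polyO := by
  refine Metric.denseRange_iff.2 fun t ε hε => ?_
  obtain ⟨p, hp⟩ := P.exists_poly_norm_lt t hε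
  refine ⟨p, ?_⟩
  rwa [Subtype.dist_eq, dist_eq_norm]

/-! ### Algebra of the Carlitz polynomials -/

lemma add_pow_q (a b : P.K) : (a + b) ^ P.q = a ^ P.q + b ^ P.q :=
  map_add (FiniteField.frobeniusAlgHom F P.K) a b

lemma sub_pow_q (a b : P.K) : (a - b) ^ P.q = a ^ P.q - b ^ P.q :=
  map_sub (FiniteField.frobeniusAlgHom F P.K) a b

lemma coe_smul_pow_q (a : F) : (algebraMap F P.K a) ^ P.q = algebraMap F P.K a := by
  rw [← map_pow, FiniteField.pow_card]

@[simp] lemma e_zero (t : P.K) : P.e 0 t = t := by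
  have : (finite_degree_lt (F := F) 0).toFinset = {0} := by
    ext ω; simp [Nat.WithBot.lt_zero_iff]
  rw [e, this]; simp

/-- Each polynomial of degree at most i is uniquely a X^i + ω with deg ω < i. -/
lemma e_succ_eq_prod (i : ℕ) (t : P.K) :
    P.e (i + 1) t = ∏ a : F, P.e i (t - algebraMap F P.K a * P.x ^ i) := by
  simp only [e]
  rw [← Finset.prod_product']
  symm
  refine Finset.prod_bij' (fun z _ => C z.1 * X ^ i + z.2)
    (fun η _ => (η.coeff i, η - C (η.coeff i) * X ^ i)) ?_ ?_ ?_ ?_ ?_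
  · rintro ⟨a, ω⟩ h
    simp only [Finset.mem_product, Set.Finite.mem_toFinset, Set.mem_ofPred_eq] at h ⊢
    refine (degree_add_le _ _).trans_lt (max_lt ?_ (h.2.trans ?_))
    · exact (degree_C_mul_X_pow_le _ _).trans_lt (by exact_mod_cast Nat.lt_succ_self i)
    · exact_mod_cast Nat.lt_succ_self i
  · intro η h
    simp only [Finset.mem_product, Set.Finite.mem_toFinset, Set.mem_ofPred_eq, Finset.mem_univ,
      true_and] at h ⊢
    rw [degree_lt_iff_coeff_zero] at h ⊢
    intro m hm
    rcases hm.eq_or_lt with rfl | hm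
    · simp
    · rw [coeff_sub, h m hm, coeff_C_mul_X_pow, if_neg hm.ne', sub_zero]
  · rintro ⟨a, ω⟩ h
    simp only [Finset.mem_product, Set.Finite.mem_toFinset, Set.mem_ofPred_eq, Finset.mem_univ,
      true_and] at h
    have : ω.coeff i = 0 := coeff_eq_zero_of_degree_lt h
    simp [this]
  · intro η h
    simp
  · rintro ⟨a, ω⟩ h
    rw [map_add, map_mul, map_pow, ← x_eq]
    change _ = t - (algebraMap F P.K a * _ + _)
    ring

lemma e_algebraMap_eq_zero {i : ℕ} {p : F[X]} (h : p.degree < i) :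
    P.e i (algebraMap F[X] P.K p) = 0 :=
  Finset.prod_eq_zero (i := p) (by simpa using h) (by simp)

lemma e_succ_of_linear {i : ℕ} (hadd : ∀ s t, P.e i (s + t) = P.e i s + P.e i t)
    (hsmul : ∀ (a : F) t, P.e i (algebraMap F P.K a * t) = algebraMap F P.K a * P.e i t)
    (t : P.K) :
    P.e (i + 1) t = P.e i t ^ P.q - P.e i (P.x ^ i) ^ (P.q - 1) * P.e i t := by
  rw [e_succ_eq_prod, ← FiniteField.prod_sub_algebraMap_mul]
  refine Finset.prod_congr rfl fun a _ => ?_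
  rw [← hsmul, sub_eq_add_neg, hadd, ← neg_mul, ← map_neg, hsmul, map_neg, neg_mul,
    ← sub_eq_add_neg, hsmul]

lemma e_linear (i : ℕ) : (∀ s t, P.e i (s + t) = P.e i s + P.e i t) ∧
    ∀ (a : F) t, P.e i (algebraMap F P.K a * t) = algebraMap F P.K a * P.e i t := by
  induction i with
  | zero => simp
  | succ i ih =>
    have h := P.e_succ_of_linear ih.1 ih.2
    refine ⟨fun s t => ?_, fun a t => ?_⟩
    · rw [h, h, h, ih.1, add_pow_q]; ring
    · rw [h, h, ih.2, mul_pow, coe_smul_pow_q]; ring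

lemma D_zero : P.D 0 = 1 := by simp [D]

lemma D_succ (i : ℕ) : P.D (i + 1) = P.brk (i + 1) * P.D i ^ P.q := by
  rw [D, Finset.prod_Icc_succ_top (by omega), D, ← Finset.prod_pow, mul_comm]
  congr 1
  · simp
  · refine Finset.prod_congr rfl fun j hj => ?_
    rw [← pow_mul, ← pow_succ]
    rw [Finset.mem_Icc] at hj
    congr 2; omega

lemma L_zero : P.L 0 = 1 := by simp [L]

lemma L_succ (i : ℕ) : P.L (i + 1) = P.brk (i + 1) * P.L i := by
  rw [L, Finset.prod_Icc_succ_top (by omega), L, mul_comm]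

lemma D_ne_zero (i : ℕ) : P.D i ≠ 0 := by
  induction i with
  | zero => simp [D_zero]
  | succ i ih => rw [D_succ]; exact mul_ne_zero (P.brk_ne_zero (by omega)) (pow_ne_zero _ ih)

lemma L_ne_zero (i : ℕ) : P.L i ≠ 0 := by
  induction i with
  | zero => simp [L_zero]
  | succ i ih => rw [L_succ]; exact mul_ne_zero (P.brk_ne_zero (by omega)) ih

lemma brk_succ (i : ℕ) : P.brk (i + 1) = P.brk i ^ P.q + P.brk 1 := by
  simp only [brk, sub_pow_q, ← pow_mul, ← pow_succ, pow_one]; ring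

/-- The two claims need each other: the value D_i makes the recursion for e_(i+1) explicit, and the
relation at t = x^i, where e_(i+1) vanishes, gives the next value. -/
lemma e_x_pow_and_e_x_mul (i : ℕ) : P.e i (P.x ^ i) = P.D i ∧
    ∀ t, P.e (i + 1) (P.x * t) = P.x * P.e (i + 1) t + P.brk (i + 1) * P.e i t ^ P.q := by
  have hs := fun i => P.e_succ_of_linear (P.e_linear i).1 (P.e_linear i).2
  induction i with
  | zero =>
    have h1 : P.e 0 (P.x ^ 0) = P.D 0 := by simp [D_zero]
    refine ⟨h1, fun t => ?_⟩
    rw [hs, hs, h1, D_zero]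
    simp only [e_zero, brk, one_pow, mul_pow, zero_add, pow_one]
    ring
  | succ i ih =>
    have h1 : P.e (i + 1) (P.x ^ (i + 1)) = P.D (i + 1) := by
      have h0 : P.e (i + 1) (P.x ^ i) = 0 := by
        rw [x_eq, ← map_pow]
        refine P.e_algebraMap_eq_zero ?_
        rw [degree_X_pow]; exact_mod_cast Nat.lt_succ_self i
      rw [pow_succ', ih.2, ih.1, h0, D_succ, mul_zero, zero_add]
    refine ⟨h1, fun t => ?_⟩
    have h2 : P.e (i + 1) t ^ P.q =
        (P.e i t ^ P.q) ^ P.q - (P.D i ^ P.q) ^ (P.q - 1) * P.e i t ^ P.q := by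
      rw [hs, ih.1, sub_pow_q, mul_pow, pow_right_comm (P.D i)]
    have hD : P.D (i + 1) ^ (P.q - 1) * P.brk (i + 1) =
        P.brk (i + 1) ^ P.q * (P.D i ^ P.q) ^ (P.q - 1) := by
      have hq' : P.q - 1 + 1 = P.q := Nat.sub_add_cancel Fintype.card_pos
      rw [D_succ, mul_pow]
      nth_rewrite 4 [← hq']
      rw [pow_succ]; ring
    have h3 : P.x ^ P.q = P.x + P.brk 1 := by rw [brk, pow_one]; ring
    rw [hs (i + 1), hs (i + 1) t, ih.2, h1, add_pow_q, mul_pow, mul_pow, h3, P.brk_succ (i + 1)]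
    linear_combination (-P.e i t ^ P.q) * hD - P.brk (i + 1) ^ P.q * h2

lemma f_zero (t : P.K) : P.f 0 t = t := by simp [f, D_zero]

lemma f_add (i : ℕ) (s t : P.K) : P.f i (s + t) = P.f i s + P.f i t := by
  rw [f, (P.e_linear i).1, add_div, f, f]

lemma f_smul (i : ℕ) (a : F) (t : P.K) :
    P.f i (algebraMap F P.K a * t) = algebraMap F P.K a * P.f i t := by
  rw [f, (P.e_linear i).2, mul_div_assoc, f]

lemma f_algebraMap_eq_zero {i : ℕ} {p : F[X]} (h : p.degree < i) :
    P.f i (algebraMap F[X] P.K p) = 0 := by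
  rw [f, P.e_algebraMap_eq_zero h, zero_div]

/-- A Pascal-type rule: it is the recursion satisfied by the coefficients of X^k in the Newton basis
with nodes x^(q^i), and its coefficients are integral. -/
lemma f_succ_x_mul (i : ℕ) (t : P.K) :
    P.f (i + 1) (P.x * t) = P.f i t + P.x ^ P.q ^ (i + 1) * P.f (i + 1) t := by
  have hs := P.e_succ_of_linear (P.e_linear i).1 (P.e_linear i).2 t
  have h0 := P.e_x_pow_and_e_x_mul i
  have hD := P.D_ne_zero i
  have hb := P.brk_ne_zero (n := i + 1) (by omega)
  have hx : P.x ^ P.q ^ (i + 1) = P.brk (i + 1) + P.x := by rw [brk]; ring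
  have hq' : P.D i ^ P.q = P.D i ^ (P.q - 1) * P.D i := by
    rw [← pow_succ, Nat.sub_add_cancel Fintype.card_pos]
  rw [h0.1] at hs
  rw [f, f, f, h0.2, D_succ, hx, div_add' _ _ _ hD, eq_comm]
  rw [hs, hq']
  have : P.D i ^ (P.q - 1) ≠ 0 := pow_ne_zero _ hD
  field_simp
  ring

lemma continuous_f (i : ℕ) : Continuous (P.f i) := by
  unfold f e
  fun_prop

lemma f_x_pow_eq_zero {i k : ℕ} (h : k < i) : P.f i (P.x ^ k) = 0 := by
  rw [x_eq, ← map_pow]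
  refine P.f_algebraMap_eq_zero ?_
  rw [degree_X_pow]; exact_mod_cast h

lemma norm_f_x_pow_le (k i : ℕ) : ‖P.f i (P.x ^ k)‖ ≤ 1 := by
  induction k generalizing i with
  | zero =>
    rcases i.eq_zero_or_pos with rfl | hi
    · simp [f_zero]
    · rw [P.f_x_pow_eq_zero hi]; simp
  | succ k ih =>
    rw [pow_succ']
    rcases i with _ | i
    · rw [f_zero, norm_mul, norm_pow]
      exact mul_le_one₀ P.norm_x_le (by positivity) (pow_le_one₀ (norm_nonneg _) P.norm_x_le)
    · rw [f_succ_x_mul]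
      refine (IsUltrametricDist.norm_add_le_max _ _).trans (max_le (ih i) ?_)
      rw [norm_mul, norm_pow]
      exact mul_le_one₀ (pow_le_one₀ (norm_nonneg _) P.norm_x_le) (norm_nonneg _) (ih _)

lemma norm_algebraMap_F_le (a : F) : ‖algebraMap F P.K a‖ ≤ 1 := P.norm_algebraMap_poly_le (C a)

lemma norm_f_algebraMap_le (i : ℕ) (p : F[X]) : ‖P.f i (algebraMap F[X] P.K p)‖ ≤ 1 := by
  induction p using Polynomial.induction_on' with
  | add p p' hp hp' =>
    rw [map_add, f_add]
    exact (IsUltrametricDist.norm_add_le_max _ _).trans (max_le hp hp')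
  | monomial k a =>
    rw [← C_mul_X_pow_eq_monomial, map_mul, map_pow, ← x_eq]
    change ‖P.f i (algebraMap F P.K a * _)‖ ≤ 1
    rw [f_smul, norm_mul]
    exact mul_le_one₀ (P.norm_algebraMap_F_le a) (norm_nonneg _) (P.norm_f_x_pow_le k i)

lemma norm_f_le (i : ℕ) (t : P.O) : ‖P.f i t‖ ≤ 1 := by
  refine P.denseRange_polyO.induction_on t ?_ fun p => P.norm_f_algebraMap_le i p
  exact isClosed_le ((P.continuous_f i).comp continuous_subtype_val).norm continuous_const

/-! ### The action of K_π[X] on functions -/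

instance : IsUltrametricDist P.Ω := IsUltrametricDist.of_normedAlgebra P.K

lemma F_smul_KAlg (a : F) (z : P.KAlg) :
    a • z = algebraMap P.K P.KAlg (algebraMap F P.K a) * z := by
  rw [Algebra.smul_def, IsScalarTower.algebraMap_apply F P.K P.KAlg]

lemma F_smul_Ω (a : F) (z : P.Ω) : a • z = algebraMap P.K P.Ω (algebraMap F P.K a) * z := by
  induction z using UniformSpace.Completion.induction_on with
  | hp => exact isClosed_eq (continuous_const_smul a) (continuous_const.mul continuous_id)
  | ih z =>
    rw [← UniformSpace.Completion.coe_smul, F_smul_KAlg, UniformSpace.Completion.coe_mul]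
    rfl

lemma coe_F_smul_O (a : F) (t : P.O) : ((a • t : P.O) : P.K) = algebraMap F P.K a * t := by
  rw [← Algebra.smul_def]; rfl

/-- The operator `u(t) ↦ u(xt)` on functions `O_π → Ω_π`. -/
def shift : Module.End P.K (P.O → P.Ω) := LinearMap.funLeft P.K P.Ω fun t => P.xO * t

/-- The action of polynomials over `K_π` on functions `O_π → Ω_π` for which the variable acts by
`u(t) ↦ u(xt)`. -/
def act (p : P.K[X]) : Module.End P.K (P.O → P.Ω) := aeval P.shift p

lemma shift_apply (u : P.O → P.Ω) (t : P.O) : P.shift u t = u (P.xO * t) := rfl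

lemma act_mul (p p' : P.K[X]) (u : P.O → P.Ω) : P.act (p * p') u = P.act p (P.act p' u) := by
  simp [act]

lemma act_add (p p' : P.K[X]) (u : P.O → P.Ω) : P.act (p + p') u = P.act p u + P.act p' u := by
  simp [act]

lemma act_sub (p p' : P.K[X]) (u : P.O → P.Ω) : P.act (p - p') u = P.act p u - P.act p' u := by
  simp [act]

lemma act_C (c : P.K) (u : P.O → P.Ω) : P.act (C c) u = c • u := by
  simp [act, Module.algebraMap_end_apply]

lemma act_one (u : P.O → P.Ω) : P.act 1 u = u := by simp [act]

lemma act_X (u : P.O → P.Ω) : P.act X u = P.shift u := by simp [act]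

lemma act_X_pow (k : ℕ) (u : P.O → P.Ω) (t : P.O) :
    P.act (X ^ k) u t = u (P.xO ^ k * t) := by
  induction k generalizing t with
  | zero => simp [act_one]
  | succ k ih => rw [pow_succ', act_mul, act_X, shift_apply, ih, ← mul_assoc, pow_succ]

lemma act_C_mul_X_pow (c : P.K) (k : ℕ) (u : P.O → P.Ω) (t : P.O) :
    P.act (C c * X ^ k) u t = c • u (P.xO ^ k * t) := by
  rw [act_mul, act_C, Pi.smul_apply, act_X_pow]

lemma act_sum {ι : Type*} (s : Finset ι) (p : ι → P.K[X]) (u : P.O → P.Ω) :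
    P.act (∑ i ∈ s, p i) u = ∑ i ∈ s, P.act (p i) u := by
  simp [act, map_sum, LinearMap.sum_apply]

lemma act_apply (p : P.K[X]) (u : P.O → P.Ω) (t : P.O) :
    P.act p u t = ∑ k ∈ Finset.range (p.natDegree + 1), p.coeff k • u (P.xO ^ k * t) := by
  conv_lhs => rw [p.as_sum_range_C_mul_X_pow]
  simp_rw [act_sum, Finset.sum_apply, act_C_mul_X_pow]

lemma carlitzDelta_eq_act (u : P.O → P.Ω) : P.carlitzDelta u = P.act (X - C P.x) u := by
  ext t
  rw [carlitzDelta, act_sub, act_X, act_C, Pi.sub_apply, Pi.smul_apply, shift_apply,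
    Algebra.smul_def]

lemma carlitzDelta_act (p : P.K[X]) (u : P.O → P.Ω) :
    P.carlitzDelta (P.act p u) = P.act p (P.carlitzDelta u) := by
  rw [carlitzDelta_eq_act, carlitzDelta_eq_act, ← act_mul, ← act_mul, mul_comm]

/-- The continuous `F`-linear functions `O_π → Ω_π`, as a space over `K_π`. -/
def contLin : Submodule P.K (P.O → P.Ω) where
  carrier := {u | Continuous u ∧ (∀ s t, u (s + t) = u s + u t) ∧ ∀ (a : F) t, u (a • t) = a • u t}
  add_mem' {u v} hu hv := ⟨hu.1.add hv.1, fun s t => by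
    simp only [Pi.add_apply, hu.2.1, hv.2.1]; abel, fun a t => by
    simp only [Pi.add_apply, hu.2.2, hv.2.2, smul_add]⟩
  zero_mem' := ⟨continuous_const, by simp, by simp⟩
  smul_mem' c u hu := ⟨hu.1.const_smul c, fun s t => by
    simp only [Pi.smul_apply, hu.2.1, smul_add], fun a t => by
    rw [Pi.smul_apply, Pi.smul_apply, hu.2.2, F_smul_Ω, F_smul_Ω, Algebra.smul_def,
      Algebra.smul_def]
    ring⟩

/-- A member of `contLin` as a bundled map. -/
def contLinToCLM (u : P.contLin) : P.O →L[F] P.Ω where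
  toFun := u
  map_add' := u.2.2.1
  map_smul' := u.2.2.2
  cont := u.2.1

lemma coe_mem_contLin (u : P.O →L[F] P.Ω) : (u : P.O → P.Ω) ∈ P.contLin :=
  ⟨u.continuous, map_add u, map_smul u⟩

variable {P} in
lemma comp_mul_mem_contLin {u : P.O → P.Ω} (hu : u ∈ P.contLin) (s : P.O) :
    (fun t => u (s * t)) ∈ P.contLin :=
  ⟨hu.1.comp (continuous_const.mul continuous_id), fun t t' => by
    simp only [mul_add, hu.2.1], fun a t => by simp only [mul_smul_comm, hu.2.2]⟩

variable {P} in
lemma act_mem_contLin {u : P.O → P.Ω} (hu : u ∈ P.contLin) (p : P.K[X]) :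
    P.act p u ∈ P.contLin := by
  induction p using Polynomial.induction_on' with
  | add p p' h h' => rw [act_add]; exact add_mem h h'
  | monomial k c =>
    rw [← C_mul_X_pow_eq_monomial]
    have : P.act (C c * X ^ k) u = c • fun t => u (P.xO ^ k * t) := by
      ext t; rw [act_C_mul_X_pow, Pi.smul_apply]
    rw [this]
    exact Submodule.smul_mem _ _ (comp_mul_mem_contLin hu _)

lemma polyO_add (p p' : F[X]) : P.polyO (p + p') = P.polyO p + P.polyO p' :=
  Subtype.ext (map_add _ _ _)

lemma polyO_C_mul_X_pow (a : F) (k : ℕ) : P.polyO (C a * X ^ k) = a • P.xO ^ k := by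
  apply Subtype.ext
  rw [coe_polyO, coe_F_smul_O, map_mul, map_pow, ← x_eq]; rfl

variable {P} in
-- F-linearity moves coefficients from F inside u; coefficients in K_π would not pass.
lemma act_map {u : P.O → P.Ω} (hu : u ∈ P.contLin) (p : F[X]) (t : P.O) :
    P.act (p.map (algebraMap F P.K)) u t = u (P.polyO p * t) := by
  induction p using Polynomial.induction_on' with
  | add p p' h h' => rw [Polynomial.map_add, act_add, Pi.add_apply, h, h', polyO_add, add_mul,
      hu.2.1]
  | monomial k a =>
    rw [← C_mul_X_pow_eq_monomial, Polynomial.map_mul, Polynomial.map_pow, map_C, map_X,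
      act_C_mul_X_pow, polyO_C_mul_X_pow, smul_mul_assoc, hu.2.2, F_smul_Ω, Algebra.smul_def]

variable {P} in
lemma norm_act_le {u : P.O → P.Ω} {M ρ : ℝ} (hM : ∀ t, ‖u t‖ ≤ M) {p : P.K[X]} (hρ : 0 ≤ ρ)
    (hp : ∀ k, ‖p.coeff k‖ ≤ ρ) (t : P.O) : ‖P.act p u t‖ ≤ ρ * M := by
  rw [act_apply]
  refine IsUltrametricDist.norm_sum_le_of_forall_le_of_nonneg
    (mul_nonneg hρ ((norm_nonneg _).trans (hM 0))) fun k _ => ?_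
  rw [norm_smul]
  exact mul_le_mul (hp k) (hM _) (norm_nonneg _) hρ

/-! ### Newton basis and Carlitz expansions -/

/-- The polynomial `∏_{j < i} (X - x^(q^j))` over `K_π`. -/
def newton (i : ℕ) : P.K[X] := ∏ j ∈ Finset.range i, (X - C (P.x ^ P.q ^ j))

lemma newton_zero : P.newton 0 = 1 := by simp [newton]

lemma newton_succ (i : ℕ) : P.newton (i + 1) = P.newton i * (X - C (P.x ^ P.q ^ i)) := by
  rw [newton, Finset.prod_range_succ, newton]

/-- Multiply by X = (X - x^(q^i)) + x^(q^i) and compare with `f_succ_x_mul`. -/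
lemma X_pow_eq_sum_newton (k : ℕ) :
    (X ^ k : P.K[X]) = ∑ i ∈ Finset.range (k + 1), C (P.f i (P.x ^ k)) * P.newton i := by
  induction k with
  | zero => simp [newton_zero, f_zero]
  | succ k ih =>
    have h1 : ∑ i ∈ Finset.range (k + 1), C (P.f i (P.x ^ k) * P.x ^ P.q ^ i) * P.newton i =
        ∑ i ∈ Finset.range (k + 1 + 1), C (P.f i (P.x ^ k) * P.x ^ P.q ^ i) * P.newton i := by
      rw [Finset.sum_range_succ _ (k + 1), P.f_x_pow_eq_zero (Nat.lt_succ_self k)]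
      simp
    have h2 : (X ^ (k + 1) : P.K[X]) =
        ∑ i ∈ Finset.range (k + 1), C (P.f i (P.x ^ k)) * P.newton (i + 1) +
        ∑ i ∈ Finset.range (k + 1), C (P.f i (P.x ^ k) * P.x ^ P.q ^ i) * P.newton i := by
      rw [pow_succ, ih, Finset.sum_mul, ← Finset.sum_add_distrib]
      refine Finset.sum_congr rfl fun i _ => ?_
      rw [newton_succ, C_mul]; ring
    rw [h2, h1, Finset.sum_range_succ' _ (k + 1), Finset.sum_range_succ' _ (k + 1), ← add_assoc,
      ← Finset.sum_add_distrib]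
    congr 1
    · refine Finset.sum_congr rfl fun i _ => ?_
      rw [pow_succ' P.x, f_succ_x_mul, C_add, C_mul, C_mul]; ring
    · simp [f_zero, pow_succ]

/-- The coefficient of `f_i` in the Carlitz expansion of `u`. -/
def coef (u : P.O → P.Ω) (i : ℕ) : P.Ω := P.act (P.newton i) u 1

variable {P} in
-- At a polynomial the expansion is finite, as f_i vanishes in degrees below i; no convergence is
-- involved.
lemma eventually_polyO_eq_sum {u : P.O → P.Ω} (hu : u ∈ P.contLin) (p : F[X]) :
    ∀ᶠ N in atTop, u (P.polyO p) = ∑ i ∈ Finset.range N,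
      P.coef u i * algebraMap P.K P.Ω (P.f i (P.polyO p)) := by
  induction p using Polynomial.induction_on' with
  | add p p' h h' =>
    filter_upwards [h, h'] with N h h'
    rw [polyO_add, hu.2.1, h, h', ← Finset.sum_add_distrib]
    refine Finset.sum_congr rfl fun i _ => ?_
    change _ = _ * algebraMap P.K P.Ω (P.f i ((P.polyO p : P.K) + P.polyO p'))
    rw [f_add, map_add, mul_add]
  | monomial k a =>
    filter_upwards [eventually_ge_atTop (k + 1)] with N hN
    rw [← C_mul_X_pow_eq_monomial, polyO_C_mul_X_pow, hu.2.2]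
    have h := congrFun (congrArg (fun p => P.act p u) (P.X_pow_eq_sum_newton k)) 1
    simp only [act_X_pow, mul_one, act_sum, Finset.sum_apply, act_mul, act_C, Pi.smul_apply] at h
    rw [h, Finset.smul_sum]
    have h' : ((a • P.xO ^ k : P.O) : P.K) = algebraMap F P.K a * P.x ^ k := by
      rw [coe_F_smul_O]; rfl
    refine Finset.sum_subset_zero_on_sdiff (Finset.range_mono hN) ?_ ?_
    · intro i hi
      simp only [Finset.mem_sdiff, Finset.mem_range, not_lt] at hi
      rw [h', f_smul, P.f_x_pow_eq_zero (by omega)]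
      simp
    · intro i _
      rw [h', f_smul, map_mul, F_smul_Ω, Algebra.smul_def, coef]; ring

variable {P} in
/-- A continuous `F`-linear function whose coefficients tend to zero is the sum of its Carlitz
expansion. -/
lemma hasCarlitzExpansion {u : P.O → P.Ω} (hu : u ∈ P.contLin)
    (h : Tendsto (P.coef u) atTop (𝓝 0)) : P.HasCarlitzExpansion u (P.coef u) := by
  refine Metric.tendstoUniformly_iff.2 fun ε hε => ?_
  obtain ⟨N₀, hN₀⟩ := Metric.tendsto_atTop.1 h (ε / 2) (half_pos hε)
  filter_upwards [eventually_ge_atTop N₀] with N hN t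
  refine lt_of_le_of_lt ?_ (half_lt_self hε)
  -- The non-strict bound ε/2 is a closed condition, so it may be checked at polynomials.
  refine P.denseRange_polyO.induction_on t ?_ fun p => ?_
  · refine isClosed_le (hu.1.dist (continuous_finsetSum _ fun i _ => ?_)) continuous_const
    exact continuous_const.mul
      ((algebraMapCLM P.K P.Ω).continuous.comp ((P.continuous_f i).comp continuous_subtype_val))
  · obtain ⟨M, hM, hMN⟩ := ((eventually_polyO_eq_sum hu p).and (eventually_ge_atTop N)).exists
    rw [hM, dist_eq_norm, ← Finset.sum_range_add_sum_Ico _ hMN, add_sub_cancel_left]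
    refine IsUltrametricDist.norm_sum_le_of_forall_le_of_nonneg (half_pos hε).le fun i hi => ?_
    rw [norm_mul, norm_Ω]
    have := hN₀ i (hN.trans (Finset.mem_Ico.1 hi).1)
    rw [dist_zero_right] at this
    exact (mul_le_of_le_one_right (norm_nonneg _) (P.norm_f_le i _)).trans this.le

/-! ### The polylogarithm series on πO_π -/

lemma add_pow_q_pow (j : ℕ) (a b : P.K) : (a + b) ^ P.q ^ j = a ^ P.q ^ j + b ^ P.q ^ j := by
  induction j with
  | zero => simp
  | succ j ih => rw [pow_succ, pow_mul, ih, add_pow_q, ← pow_mul, ← pow_mul]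

lemma sub_pow_q_pow (j : ℕ) (a b : P.K) : (a - b) ^ P.q ^ j = a ^ P.q ^ j - b ^ P.q ^ j := by
  rw [eq_sub_iff_add_eq, ← add_pow_q_pow, sub_add_cancel]

lemma algebraMap_F_pow_q_pow (j : ℕ) (a : F) :
    algebraMap F P.K a ^ P.q ^ j = algebraMap F P.K a := by
  rw [← map_pow, FiniteField.pow_card_pow]

/-- The image of `π` in `K_π`. -/
def unif : P.K := algebraMap F[X] P.K P.poly

lemma norm_unif : ‖P.unif‖ = P.r := P.norm_algebraMap_poly

lemma unif_ne_zero : P.unif ≠ 0 := norm_pos_iff.1 (P.norm_unif ▸ P.r_pos)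

@[simp] lemma coe_polyO_poly : (P.polyO P.poly : P.K) = P.unif := rfl

lemma self_le_q_pow (j : ℕ) : j ≤ P.q ^ j := (Nat.lt_pow_self P.one_lt_q).le

lemma norm_polylog_term_le (n j i : ℕ) (hij : i ≤ P.q ^ (j + 1)) {w : P.K} (hw : ‖w‖ ≤ P.r) :
    ‖w ^ P.q ^ (j + 1) / P.brk (j + 1) ^ n‖ ≤ (P.r ^ n)⁻¹ * P.r ^ i := by
  rw [norm_div, norm_pow, norm_pow, div_eq_inv_mul]
  refine mul_le_mul ?_ ?_ (by positivity) (by have := P.r_pos; positivity)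
  · exact inv_anti₀ (pow_pos P.r_pos _)
      (pow_le_pow_left₀ P.r_pos.le (P.le_norm_brk (by omega)) _)
  · exact (pow_le_pow_left₀ (norm_nonneg _) hw _).trans
      (pow_le_pow_of_le_one P.r_pos.le P.r_lt_one.le hij)

/-- The `j`-th term of the series for the `n`-th polylogarithm at `π t`. -/
def polylogTerm (n : ℕ) (t : P.O) (j : ℕ) : P.Ω :=
  algebraMap P.K P.Ω ((P.unif * (t : P.K)) ^ P.q ^ (j + 1) / P.brk (j + 1) ^ n)

lemma norm_unif_mul_le (t : P.O) : ‖P.unif * (t : P.K)‖ ≤ P.r := by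
  rw [norm_mul, norm_unif]
  exact mul_le_of_le_one_right P.r_pos.le t.2

lemma norm_polylogTerm_le (n : ℕ) (t : P.O) {i j : ℕ} (hij : i ≤ P.q ^ (j + 1)) :
    ‖P.polylogTerm n t j‖ ≤ (P.r ^ n)⁻¹ * P.r ^ i := by
  rw [polylogTerm, norm_Ω]
  exact P.norm_polylog_term_le n j i hij (P.norm_unif_mul_le t)

lemma norm_polylogTerm_le_pow (n : ℕ) (t : P.O) (j : ℕ) :
    ‖P.polylogTerm n t j‖ ≤ (P.r ^ n)⁻¹ * P.r ^ j :=
  P.norm_polylogTerm_le n t ((Nat.le_succ j).trans (P.self_le_q_pow _))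

lemma summable_bound (n : ℕ) : Summable fun j : ℕ => (P.r ^ n)⁻¹ * P.r ^ j :=
  (summable_geometric_of_lt_one P.r_pos.le P.r_lt_one).mul_left _

lemma summable_polylogTerm (n : ℕ) (t : P.O) : Summable (P.polylogTerm n t) :=
  Summable.of_norm_bounded (P.summable_bound n) (P.norm_polylogTerm_le_pow n t)

/-- The function `t ↦ ∑_{j ≥ 1} (π t)^(q^j) / [j]^n` on `O_π`. -/
def polylog (n : ℕ) (t : P.O) : P.Ω := ∑' j, P.polylogTerm n t j

lemma hasSum_polylog (n : ℕ) (t : P.O) : HasSum (P.polylogTerm n t) (P.polylog n t) :=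
  (P.summable_polylogTerm n t).hasSum

lemma polylog_mem_contLin (n : ℕ) : P.polylog n ∈ P.contLin := by
  refine ⟨?_, fun s t => ?_, fun a t => ?_⟩
  · refine continuous_tsum (fun j => ?_) (P.summable_bound n)
      fun j t => P.norm_polylogTerm_le_pow n t j
    refine (algebraMapCLM P.K P.Ω).continuous.comp (Continuous.div_const ?_ _)
    exact (continuous_const.mul continuous_subtype_val).pow _
  · refine (P.hasSum_polylog n (s + t)).unique ?_
    convert (P.hasSum_polylog n s).add (P.hasSum_polylog n t) using 1
    ext j
    rw [polylogTerm, polylogTerm, polylogTerm, ← map_add]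
    change algebraMap P.K P.Ω ((P.unif * ((s : P.K) + t)) ^ _ / _) = _
    rw [mul_add, add_pow_q_pow, add_div]
  · have h : P.polylogTerm n (a • t) =
        fun j => algebraMap P.K P.Ω (algebraMap F P.K a) * P.polylogTerm n t j := by
      ext j
      rw [polylogTerm, polylogTerm, ← map_mul, coe_F_smul_O, mul_left_comm, mul_pow,
        algebraMap_F_pow_q_pow, mul_div_assoc]
    rw [F_smul_Ω, polylog, polylog, h, tsum_mul_left]

lemma norm_hasSum_le {a : ℕ → P.Ω} {s : P.Ω} (h : HasSum a s) {b : ℝ} (hb : 0 ≤ b)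
    (ha : ∀ j, ‖a j‖ ≤ b) : ‖s‖ ≤ b :=
  le_of_tendsto h.norm (Eventually.of_forall fun _ =>
    IsUltrametricDist.norm_sum_le_of_forall_le_of_nonneg hb fun j _ => ha j)

/-- Each term is an eigenfunction of the shift with eigenvalue x^(q^(j+1)). For X - x the eigenvalue
is [j+1], so Δ lowers the index of the polylogarithm by one. -/
lemma hasSum_act_polylog (p : P.K[X]) (n : ℕ) (t : P.O) :
    HasSum (fun j => algebraMap P.K P.Ω (p.eval (P.x ^ P.q ^ (j + 1))) * P.polylogTerm n t j)
      (P.act p (P.polylog n) t) := by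
  rw [act_apply]
  have h := hasSum_sum (s := Finset.range (p.natDegree + 1)) fun k _ =>
    (P.hasSum_polylog n (P.xO ^ k * t)).const_smul (p.coeff k)
  convert h using 2 with j
  rw [eval_eq_sum_range, map_sum, Finset.sum_mul]
  refine Finset.sum_congr rfl fun k _ => ?_
  rw [polylogTerm, polylogTerm, Algebra.smul_def, ← map_mul, ← map_mul]
  congr 1
  change _ = _ * ((P.unif * (P.x ^ k * (t : P.K))) ^ _ / _)
  rw [mul_left_comm, mul_pow (P.x ^ k), pow_right_comm P.x]
  ring

lemma carlitzDelta_polylog (n : ℕ) : P.carlitzDelta (P.polylog (n + 1)) = P.polylog n := by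
  ext t
  rw [carlitzDelta_eq_act]
  refine (P.hasSum_act_polylog _ (n + 1) t).unique ?_
  convert P.hasSum_polylog n t using 2 with j
  have hb := P.brk_ne_zero (n := j + 1) (by omega)
  rw [polylogTerm, polylogTerm, ← map_mul]
  congr 1
  rw [eval_sub, eval_X, eval_C, ← brk, pow_succ (P.brk (j + 1))]
  field_simp

variable {P} in
-- Every t in the disc is π times an element of O_π, so the local condition becomes an identity on
-- all of O_π.
lemma agrees_iff {n : ℕ} {u : P.O → P.Ω} :
    P.AgreesWithPolylogSeries n u ↔ ∀ t, u (P.polyO P.poly * t) = P.polylog n t := by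
  constructor
  · intro h t
    exact (h (P.polyO P.poly * t) (P.norm_unif_mul_le t)).unique (P.hasSum_polylog n t)
  · intro h t ht
    have hs : ‖(t : P.K) / P.unif‖ ≤ 1 := by
      rw [norm_div, norm_unif]; exact div_le_one_of_le₀ ht P.r_pos.le
    have hst : P.unif * ((t : P.K) / P.unif) = t := mul_div_cancel₀ _ P.unif_ne_zero
    have h2 := h ⟨(t : P.K) / P.unif, hs⟩
    have h1 : P.polyO P.poly * ⟨(t : P.K) / P.unif, hs⟩ = t := Subtype.ext hst
    have h3 := P.hasSum_polylog n ⟨(t : P.K) / P.unif, hs⟩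
    rw [← h2, h1] at h3
    convert h3 using 2 with j
    rw [polylogTerm]
    change _ = algebraMap P.K P.Ω ((P.unif * ((t : P.K) / P.unif)) ^ _ / _)
    rw [hst]

/-! ### Inverting Δ -/

lemma eval_map_x (p : F[X]) : (p.map (algebraMap F P.K)).eval P.x = algebraMap F[X] P.K p := by
  induction p using Polynomial.induction_on' with
  | add p p' h h' => rw [Polynomial.map_add, eval_add, h, h', map_add]
  | monomial k a =>
    rw [← C_mul_X_pow_eq_monomial, map_mul, map_pow, ← x_eq, Polynomial.map_mul, map_C,
      Polynomial.map_pow, map_X, eval_mul, eval_C, eval_pow, eval_X]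
    rfl

lemma exists_map_poly_eq :
    ∃ B : P.K[X], P.poly.map (algebraMap F P.K) = (X - C P.x) * B + C P.unif := by
  obtain ⟨B, hB⟩ := X_sub_C_dvd_sub_C_eval (a := P.x) (p := P.poly.map (algebraMap F P.K))
  exact ⟨B, eq_add_of_sub_eq (by rw [← hB, eval_map_x, unif])⟩

/-- The quotient of `π(X) - π(x)` by `X - x`. -/
def quot : P.K[X] := P.exists_map_poly_eq.choose

lemma map_poly_eq : P.poly.map (algebraMap F P.K) = (X - C P.x) * P.quot + C P.unif :=
  P.exists_map_poly_eq.choose_spec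

variable {P} in
-- The central identity: since π ≠ 0 in K_π, it can be solved for u t.
lemma apply_poly_mul {u : P.O → P.Ω} (hu : u ∈ P.contLin) (t : P.O) :
    u (P.polyO P.poly * t) = P.act P.quot (P.carlitzDelta u) t + P.unif • u t := by
  rw [← act_map hu, map_poly_eq, mul_comm, act_add, act_mul, act_C, carlitzDelta_eq_act]
  rfl

lemma act_comp_mul (p : P.K[X]) (u : P.O → P.Ω) (s t : P.O) :
    P.act p (fun t => u (s * t)) t = P.act p u (s * t) := by
  rw [act_apply, act_apply]
  simp_rw [mul_left_comm]

/-- The solution `u` of `Δu = v` agreeing with the `n`-th polylogarithm series on `π O_π`. -/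
def integral (n : ℕ) (v : P.O → P.Ω) : P.O → P.Ω :=
  P.unif⁻¹ • (P.polylog n - P.act P.quot v)

variable {P} in
lemma integral_mem_contLin (n : ℕ) {v : P.O → P.Ω} (hv : v ∈ P.contLin) :
    P.integral n v ∈ P.contLin :=
  Submodule.smul_mem _ _ (Submodule.sub_mem _ (P.polylog_mem_contLin n) (act_mem_contLin hv _))

variable {P} in
-- Δ commutes with `quot` and lowers the polylogarithm to v(πt); then `apply_poly_mul` for v leaves
-- π v.
lemma carlitzDelta_integral {n : ℕ} {v : P.O → P.Ω} (hv : v ∈ P.contLin)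
    (h : P.AgreesWithPolylogSeries n v) : P.carlitzDelta (P.integral (n + 1) v) = v := by
  rw [integral, carlitzDelta_eq_act, map_smul, map_sub, ← carlitzDelta_eq_act,
    ← carlitzDelta_eq_act, carlitzDelta_act, carlitzDelta_polylog]
  ext t
  rw [Pi.smul_apply, Pi.sub_apply, ← agrees_iff.1 h t, apply_poly_mul hv, add_sub_cancel_left,
    inv_smul_smul₀ P.unif_ne_zero]

variable {P} in
-- At πt the function v becomes `polylog n`, which is Δ of `polylog (n + 1)`; then `apply_poly_mul`
-- applies to the latter.
lemma integral_agrees {n : ℕ} {v : P.O → P.Ω} (h : P.AgreesWithPolylogSeries n v) :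
    P.AgreesWithPolylogSeries (n + 1) (P.integral (n + 1) v) := by
  rw [agrees_iff] at h ⊢
  intro t
  rw [integral, Pi.smul_apply, Pi.sub_apply, ← act_comp_mul, funext h,
    apply_poly_mul (P.polylog_mem_contLin _), carlitzDelta_polylog, add_sub_cancel_left,
    inv_smul_smul₀ P.unif_ne_zero]

variable {P} in
lemma eq_of_carlitzDelta_eq {n : ℕ} {u v : P.O → P.Ω} (hu : u ∈ P.contLin) (hv : v ∈ P.contLin)
    (hun : P.AgreesWithPolylogSeries n u) (hvn : P.AgreesWithPolylogSeries n v)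
    (h : P.carlitzDelta u = P.carlitzDelta v) : u = v := by
  ext t
  have h1 := apply_poly_mul hu t
  rw [agrees_iff.1 hun, ← agrees_iff.1 hvn, apply_poly_mul hv, h, add_right_inj] at h1
  exact (MulAction.injective₀ P.unif_ne_zero h1).symm

/-! ### Boundedness of solutions -/

variable {P} in
lemma exists_norm_coeff_le (p : P.K[X]) : ∃ ρ : ℝ, 0 ≤ ρ ∧ ∀ k, ‖p.coeff k‖ ≤ ρ := by
  refine ⟨∑ k ∈ p.support, ‖p.coeff k‖, Finset.sum_nonneg fun _ _ => norm_nonneg _, fun k => ?_⟩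
  by_cases hk : k ∈ p.support
  · exact Finset.single_le_sum (f := fun k => ‖p.coeff k‖) (fun _ _ => norm_nonneg _) hk
  · rw [notMem_support_iff.1 hk, norm_zero]
    exact Finset.sum_nonneg fun _ _ => norm_nonneg _

lemma norm_polylog_le (n : ℕ) (t : P.O) : ‖P.polylog n t‖ ≤ (P.r ^ n)⁻¹ := by
  have := P.r_pos
  refine P.norm_hasSum_le (P.hasSum_polylog n t) (by positivity) fun j => ?_
  simpa using P.norm_polylogTerm_le n t (i := 0) (j := j) (Nat.zero_le _)

variable {P} in
lemma exists_norm_le {n : ℕ} {u : P.O → P.Ω} (hu : u ∈ P.contLin)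
    (hn : P.AgreesWithPolylogSeries n u) {M : ℝ} (hM : ∀ t, ‖P.carlitzDelta u t‖ ≤ M) :
    ∃ M', ∀ t, ‖u t‖ ≤ M' := by
  obtain ⟨ρ, hρ0, hρ⟩ := exists_norm_coeff_le P.quot
  refine ⟨P.r⁻¹ * ((P.r ^ n)⁻¹ + ρ * M), fun t => ?_⟩
  have h : u t = P.unif⁻¹ • (P.polylog n t - P.act P.quot (P.carlitzDelta u) t) := by
    rw [← agrees_iff.1 hn, apply_poly_mul hu, add_sub_cancel_left,
      inv_smul_smul₀ P.unif_ne_zero]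
  rw [h, norm_smul, norm_inv, norm_unif]
  refine mul_le_mul_of_nonneg_left ?_ (inv_nonneg.2 P.r_pos.le)
  exact (norm_sub_le _ _).trans (add_le_add (P.norm_polylog_le n t) (norm_act_le hM hρ0 hρ t))

variable {P} in
-- If |w| > 1 then |w|^q = |w - t| ≤ |w|, a contradiction. This starts the induction bounding all
-- l_n.
lemma norm_carlitzDelta_le_one {u : P.O → P.Ω} (h : P.SolvesLogEquation u) (t : P.O) :
    ‖P.carlitzDelta u t‖ ≤ 1 := by
  obtain ⟨w, hw, hwt⟩ := h
  rw [← hw t, norm_pow]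
  refine pow_le_one₀ (norm_nonneg _) ?_
  by_contra! hlt
  have h1 : ‖w t‖ < ‖w t‖ ^ P.q := lt_self_pow₀ hlt P.one_lt_q
  have h2 : w t ^ P.q = w t + -algebraMap P.K P.Ω t := by rw [← hwt t]; ring
  rw [← norm_pow, h2] at h1
  refine absurd h1 (not_lt.2 ((IsUltrametricDist.norm_add_le_max _ _).trans (max_le le_rfl ?_)))
  rw [norm_neg, norm_Ω]
  exact t.2.trans hlt.le

/-! ### Decay of the Carlitz coefficients -/

variable {P} in
lemma norm_coeff_mul_le {p p' : P.K[X]} {a b : ℝ} (ha : 0 ≤ a) (hb : 0 ≤ b)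
    (hp : ∀ k, ‖p.coeff k‖ ≤ a) (hp' : ∀ k, ‖p'.coeff k‖ ≤ b) (k : ℕ) :
    ‖(p * p').coeff k‖ ≤ a * b := by
  rw [coeff_mul]
  refine IsUltrametricDist.norm_sum_le_of_forall_le_of_nonneg (mul_nonneg ha hb) fun z _ => ?_
  rw [norm_mul]
  exact mul_le_mul (hp _) (hp' _) (norm_nonneg _) ha

variable {P} in
lemma norm_coeff_prod_le {ι : Type*} {s : Finset ι} {p : ι → P.K[X]}
    (hp : ∀ i ∈ s, ∀ k, ‖(p i).coeff k‖ ≤ 1) (k : ℕ) : ‖(∏ i ∈ s, p i).coeff k‖ ≤ 1 := by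
  revert k
  refine Finset.prod_induction p (fun p => ∀ k, ‖p.coeff k‖ ≤ 1) (fun p p' h h' k => ?_)
    (fun k => ?_) hp
  · simpa using norm_coeff_mul_le zero_le_one zero_le_one h h' k
  · rw [coeff_one]; split_ifs <;> simp

variable {P} in
lemma norm_coeff_C_le {c : P.K} {a : ℝ} (ha : 0 ≤ a) (hc : ‖c‖ ≤ a) (k : ℕ) :
    ‖(C c : P.K[X]).coeff k‖ ≤ a := by
  rw [coeff_C]; split_ifs
  · exact hc
  · simpa using ha

variable {P} in
lemma norm_coeff_X_sub_C_le {c : P.K} (hc : ‖c‖ ≤ 1) (k : ℕ) :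
    ‖(X - C c : P.K[X]).coeff k‖ ≤ 1 := by
  rw [sub_eq_add_neg, coeff_add, coeff_neg]
  refine (IsUltrametricDist.norm_add_le_max _ _).trans (max_le ?_ ?_)
  · rw [coeff_X]; split_ifs <;> simp
  · rw [norm_neg]; exact norm_coeff_C_le zero_le_one hc k

lemma norm_x_pow_le (m : ℕ) : ‖P.x ^ m‖ ≤ 1 := by
  rw [norm_pow]; exact pow_le_one₀ (norm_nonneg _) P.norm_x_le

lemma norm_coeff_newton_le (i k : ℕ) : ‖(P.newton i).coeff k‖ ≤ 1 :=
  norm_coeff_prod_le (fun _ _ => norm_coeff_X_sub_C_le (P.norm_x_pow_le _)) k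

lemma norm_eval_newton_le (i : ℕ) {y : P.K} (hy : ‖y‖ ≤ 1) : ‖(P.newton i).eval y‖ ≤ 1 := by
  rw [newton, eval_prod, norm_prod]
  refine Finset.prod_le_one (fun _ _ => norm_nonneg _) fun j _ => ?_
  rw [eval_sub, eval_X, eval_C, sub_eq_add_neg]
  refine (IsUltrametricDist.norm_add_le_max _ _).trans (max_le hy ?_)
  rw [norm_neg]; exact P.norm_x_pow_le _

lemma eval_newton_eq_zero {i j : ℕ} (h : j < i) : (P.newton i).eval (P.x ^ P.q ^ j) = 0 := by
  rw [newton, eval_prod]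
  exact Finset.prod_eq_zero (Finset.mem_range.2 h) (by simp)

/-- The product of `X - x^(q^j)` over `i ≤ j < i + δ`. -/
def newtonBlock (i : ℕ) : P.K[X] := ∏ k ∈ Finset.range P.δ, (X - C (P.x ^ P.q ^ (i + k)))

lemma newton_add (i : ℕ) : P.newton (i + P.δ) = P.newton i * P.newtonBlock i :=
  Finset.prod_range_add _ _ _

/-- The difference is [j-i]^(q^i), and δ does not divide j - i, so the bracket is a unit. -/
lemma norm_x_pow_sub_x_pow_of_lt {i j : ℕ} (hij : i < j) (h : j < i + P.δ) :
    ‖P.x ^ P.q ^ j - P.x ^ P.q ^ i‖ = 1 := by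
  have : P.x ^ P.q ^ j - P.x ^ P.q ^ i = P.brk (j - i) ^ P.q ^ i := by
    rw [brk, sub_pow_q_pow, ← pow_mul, ← pow_add, Nat.sub_add_cancel hij.le]
  rw [this, norm_pow, P.norm_brk_eq_one fun hd => ?_, one_pow]
  exact absurd (Nat.le_of_dvd (by omega) hd) (by omega)

lemma norm_node_sub_node {i k l : ℕ} (hk : k < P.δ) (hl : l < P.δ) (hkl : k ≠ l) :
    ‖P.x ^ P.q ^ (i + k) - P.x ^ P.q ^ (i + l)‖ = 1 := by
  rcases hkl.lt_or_gt with h | h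
  · rw [norm_sub_rev]; exact P.norm_x_pow_sub_x_pow_of_lt (by omega) (by omega)
  · exact P.norm_x_pow_sub_x_pow_of_lt (by omega) (by omega)

lemma eval_map_x_pow (p : F[X]) (m : ℕ) :
    (p.map (algebraMap F P.K)).eval (P.x ^ P.q ^ m) = algebraMap F[X] P.K p ^ P.q ^ m := by
  induction p using Polynomial.induction_on' with
  | add p p' h h' => rw [Polynomial.map_add, eval_add, h, h', map_add, add_pow_q_pow]
  | monomial k a =>
    rw [← C_mul_X_pow_eq_monomial, map_mul, map_pow, ← x_eq, Polynomial.map_mul, map_C,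
      Polynomial.map_pow, map_X, eval_mul, eval_C, eval_pow, eval_X, mul_pow, pow_right_comm]
    congr 1
    exact (P.algebraMap_F_pow_q_pow m a).symm

/-- Modulo `π^(q^i)`, the polynomial `π(X)` is the product of `X - x^(q^j)` over
`i ≤ j < i + δ`. -/
lemma norm_coeff_map_poly_sub_newtonBlock_le (i k : ℕ) :
    ‖(P.poly.map (algebraMap F P.K) - P.newtonBlock i).coeff k‖ ≤ P.r ^ P.q ^ i := by
  set v : ℕ → P.K := fun k => P.x ^ P.q ^ (i + k) with hv
  have hnode : ∀ k ∈ Finset.range P.δ, ∀ l ∈ Finset.range P.δ, k ≠ l → ‖v k - v l‖ = 1 :=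
    fun k hk l hl h => P.norm_node_sub_node (Finset.mem_range.1 hk) (Finset.mem_range.1 hl) h
  have hinj : Set.InjOn v (Finset.range P.δ : Set ℕ) := by
    intro k hk l hl h
    by_contra hne
    have := hnode k hk l hl hne
    rw [h, sub_self, norm_zero] at this
    exact zero_ne_one this
  have hmb : (P.newtonBlock i).Monic := monic_prod_of_monic _ _ fun k _ => monic_X_sub_C _
  have hmp : (P.poly.map (algebraMap F P.K)).Monic := P.monic.map _
  have hdb : (P.newtonBlock i).degree = (P.δ : WithBot ℕ) := by
    rw [newtonBlock, degree_prod, Finset.sum_congr rfl fun k _ => degree_X_sub_C _]; simp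
  have hdp : (P.poly.map (algebraMap F P.K)).degree = (P.δ : WithBot ℕ) := by
    rw [degree_map, degree_eq_natDegree P.irreducible.ne_zero]
  have hdeg : (P.poly.map (algebraMap F P.K) - P.newtonBlock i).degree <
      ((Finset.range P.δ).card : WithBot ℕ) := by
    rw [Finset.card_range, ← hdp]
    exact degree_sub_lt_left (hdp.trans hdb.symm) hmp.ne_zero
      (by rw [hmp.leadingCoeff, hmb.leadingCoeff])
  have heval : ∀ k ∈ Finset.range P.δ,
      (P.poly.map (algebraMap F P.K) - P.newtonBlock i).eval (v k) = P.unif ^ P.q ^ (i + k) := by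
    intro k hk
    rw [eval_sub, eval_map_x_pow, newtonBlock, eval_prod,
      Finset.prod_eq_zero hk (by simp [hv]), sub_zero, unif]
  -- Both polynomials are monic of degree δ, so their difference is its own interpolant at the δ
  -- nodes. The node differences are units, so the Lagrange basis is integral and only the values
  -- π^(q^(i+k)) matter.
  rw [Lagrange.eq_interpolate_of_eval_eq _ hinj hdeg heval, Lagrange.interpolate_apply,
    finsetSum_coeff]
  have hr := P.r_pos
  refine IsUltrametricDist.norm_sum_le_of_forall_le_of_nonneg (by positivity) fun l hl => ?_
  rw [← mul_one (P.r ^ _)]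
  refine norm_coeff_mul_le (by positivity) zero_le_one
    (norm_coeff_C_le (by positivity) ?_) (norm_coeff_prod_le fun m hm k => ?_) k
  · rw [norm_pow, norm_unif]
    exact pow_le_pow_of_le_one hr.le P.r_lt_one.le
      (Nat.pow_le_pow_right (by have := P.one_lt_q; omega) (by omega))
  · rw [Lagrange.basisDivisor, ← mul_one (1 : ℝ)]
    refine norm_coeff_mul_le zero_le_one zero_le_one (norm_coeff_C_le zero_le_one ?_)
      (norm_coeff_X_sub_C_le (P.norm_x_pow_le _)) k
    rw [norm_inv, hnode l hl m (Finset.mem_of_mem_erase hm) (Finset.ne_of_mem_erase hm).symm,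
      inv_one]

/-- Terms with j + 1 < i are annihilated; the others carry π to a power at least q^i. -/
lemma norm_act_newton_polylog_le (i n : ℕ) :
    ‖P.act (P.newton i) (P.polylog n) 1‖ ≤ (P.r ^ n)⁻¹ * P.r ^ P.q ^ i := by
  have hr := P.r_pos
  refine P.norm_hasSum_le (P.hasSum_act_polylog _ n 1) (by positivity) fun j => ?_
  by_cases hj : j + 1 < i
  · rw [P.eval_newton_eq_zero hj, map_zero, zero_mul, norm_zero]; positivity
  · rw [norm_mul, norm_Ω]
    refine (mul_le_of_le_one_left (norm_nonneg _)
      (P.norm_eval_newton_le i (P.norm_x_pow_le _))).trans (P.norm_polylogTerm_le n 1 ?_)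
    exact Nat.pow_le_pow_right (by have := P.one_lt_q; omega) (by omega)

variable {P} in
/-- The Carlitz coefficients of a bounded function given on `π O_π` by the `n`-th polylogarithm
series decay at the rate of locally analytic functions. -/
lemma exists_norm_coef_add_le {n : ℕ} {u : P.O → P.Ω} (hu : u ∈ P.contLin)
    (hn : P.AgreesWithPolylogSeries n u) {M : ℝ} (hM : ∀ t, ‖u t‖ ≤ M) :
    ∃ A : ℝ, 0 < A ∧ ∀ i, ‖P.coef u (i + P.δ)‖ ≤ A * P.r ^ P.q ^ i := by
  have hr := P.r_pos
  refine ⟨max (P.r ^ n)⁻¹ M, lt_max_of_lt_left (by positivity), fun i => ?_⟩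
  -- The last δ factors are traded for π(X), which turns u into the polylogarithm series.
  have h1 : P.newton (i + P.δ) = P.newton i * P.poly.map (algebraMap F P.K) -
      P.newton i * (P.poly.map (algebraMap F P.K) - P.newtonBlock i) := by
    rw [newton_add]; ring
  have h2 : P.act (P.poly.map (algebraMap F P.K)) u = P.polylog n := by
    ext t; rw [act_map hu, agrees_iff.1 hn]
  rw [coef, h1, act_sub, act_mul, act_mul, h2, Pi.sub_apply, sub_eq_add_neg]
  refine (IsUltrametricDist.norm_add_le_max _ _).trans (max_le ?_ ?_)
  · exact (P.norm_act_newton_polylog_le i n).trans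
      (mul_le_mul_of_nonneg_right (le_max_left _ _) (by positivity))
  · rw [norm_neg]
    refine (norm_act_le (M := P.r ^ P.q ^ i * M) (fun t => norm_act_le hM (by positivity)
      (P.norm_coeff_map_poly_sub_newtonBlock_le i) t) zero_le_one
      (P.norm_coeff_newton_le i) 1).trans ?_
    rw [one_mul, mul_comm]
    exact mul_le_mul_of_nonneg_right (le_max_right _ _) (by positivity)

variable {P} in
-- The weight r^(-i) bounds |1/L_i|, so the coefficients may later be divided by L_i.
lemma tendsto_coef_mul_inv_pow {u : P.O → P.Ω} {A : ℝ} (hA : 0 < A)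
    (h : ∀ i, ‖P.coef u (i + P.δ)‖ ≤ A * P.r ^ P.q ^ i) :
    Tendsto (fun i => ‖P.coef u i‖ * (P.r ^ i)⁻¹) atTop (𝓝 0) := by
  have hr := P.r_pos
  rw [← tendsto_add_atTop_iff_nat P.δ]
  have hlim : Tendsto (fun i => A * (P.r ^ P.δ)⁻¹ * P.r ^ i) atTop (𝓝 0) := by
    simpa using (tendsto_pow_atTop_nhds_zero_of_lt_one hr.le P.r_lt_one).const_mul
      (A * (P.r ^ P.δ)⁻¹)
  refine squeeze_zero (fun i => by positivity) (fun i => ?_) hlim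
  have h2 : i + i ≤ P.q ^ i := by
    refine le_trans ?_ (Nat.pow_le_pow_left (n := 2) P.one_lt_q i)
    cases i with
    | zero => simp
    | succ m => have := Nat.lt_two_pow_self (n := m); rw [pow_succ]; omega
  calc _ ≤ A * P.r ^ (i + i) * (P.r ^ (i + P.δ))⁻¹ := by
        refine mul_le_mul_of_nonneg_right ((h i).trans ?_) (by positivity)
        exact mul_le_mul_of_nonneg_left (pow_le_pow_of_le_one hr.le P.r_lt_one.le h2) hA.le
    _ = _ := by rw [pow_add, pow_add]; field_simp

lemma pow_le_norm_L (i : ℕ) : P.r ^ i ≤ ‖P.L i‖ := by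
  induction i with
  | zero => simp [L_zero]
  | succ i ih =>
    rw [L_succ, norm_mul, pow_succ']
    exact mul_le_mul (P.le_norm_brk (by omega)) ih (pow_nonneg P.r_pos.le _) (norm_nonneg _)

variable {P} in
lemma tendsto_coef {u : P.O → P.Ω}
    (h : Tendsto (fun i => ‖P.coef u i‖ * (P.r ^ i)⁻¹) atTop (𝓝 0)) :
    Tendsto (P.coef u) atTop (𝓝 0) := by
  refine squeeze_zero_norm (fun i => ?_) h
  exact le_mul_of_one_le_right (norm_nonneg _)
    ((one_le_inv₀ (pow_pos P.r_pos _)).2 (pow_le_one₀ P.r_pos.le P.r_lt_one.le))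

/-! ### The formula for c_0 -/

lemma coef_carlitzDelta (v : P.O → P.Ω) (i : ℕ) :
    P.coef (P.carlitzDelta v) i = P.coef v (i + 1) + P.brk i • P.coef v i := by
  have : P.newton i * (X - C P.x) = P.newton (i + 1) + C (P.brk i) * P.newton i := by
    rw [newton_succ, brk, C_sub]; ring
  rw [coef, carlitzDelta_eq_act, ← act_mul, this, act_add, act_mul, act_C]
  rfl

/-- After division by L_i the two parts of `coef_carlitzDelta` cancel between neighbours; [0] = 0
identifies the surviving first coefficient of v with c_0 of Δv. -/
lemma sum_range_coef_div_L (v : P.O → P.Ω) (N : ℕ) :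
    ∑ i ∈ Finset.range N, (-1) ^ ((i + 1) + 1) *
      (P.coef (P.carlitzDelta v) (i + 1) / algebraMap P.K P.Ω (P.L (i + 1))) =
    P.coef (P.carlitzDelta v) 0 +
      (-1) ^ (N + 1) * (P.coef v (N + 1) / algebraMap P.K P.Ω (P.L N)) := by
  induction N with
  | zero => rw [coef_carlitzDelta]; simp [L_zero, brk]
  | succ N ih =>
    have hL : algebraMap P.K P.Ω (P.L N) ≠ 0 := (_root_.map_ne_zero _).2 (P.L_ne_zero N)
    have hb : algebraMap P.K P.Ω (P.brk (N + 1)) ≠ 0 :=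
      (_root_.map_ne_zero _).2 (P.brk_ne_zero (by omega))
    rw [Finset.sum_range_succ, ih, P.coef_carlitzDelta v (N + 1), L_succ, map_mul,
      Algebra.smul_def]
    field_simp
    ring

variable {P} in
lemma hasSum_coef_div_L {v : P.O → P.Ω}
    (h : Tendsto (fun i => ‖P.coef v i‖ * (P.r ^ i)⁻¹) atTop (𝓝 0)) :
    HasSum (fun i : ℕ => (-1) ^ ((i + 1) + 1) *
      (P.coef (P.carlitzDelta v) (i + 1) / algebraMap P.K P.Ω (P.L (i + 1))))
      (P.coef (P.carlitzDelta v) 0) := by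
  have hr := P.r_pos
  have herr : Tendsto (fun N => (-1) ^ (N + 1) *
      (P.coef v (N + 1) / algebraMap P.K P.Ω (P.L N))) atTop (𝓝 0) := by
    refine squeeze_zero_norm (fun N => ?_) ((tendsto_add_atTop_iff_nat 1).2 h)
    rw [norm_mul, norm_pow, norm_neg, norm_one, one_pow, one_mul, norm_div, norm_Ω,
      div_eq_mul_inv]
    refine mul_le_mul_of_nonneg_left (inv_anti₀ (by positivity) ?_) (norm_nonneg _)
    exact (pow_le_pow_of_le_one hr.le P.r_lt_one.le (Nat.le_succ N)).trans (P.pow_le_norm_L N)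
  have hlim := (tendsto_const_nhds (x := P.coef (P.carlitzDelta v) 0)).add herr
  simp_rw [← sum_range_coef_div_L, add_zero] at hlim
  -- Terms are differences of convergent partial sums, hence tend to 0; in the complete ultrametric
  -- field this already gives unconditional summability.
  have hterm := ((tendsto_add_atTop_iff_nat 1).2 hlim).sub hlim
  simp_rw [Finset.sum_range_succ, add_sub_cancel_left, sub_self] at hterm
  have hsum := NonarchimedeanAddGroup.summable_of_tendsto_cofinite_zero
    (Nat.cofinite_eq_atTop ▸ hterm)
  rw [← tendsto_nhds_unique hsum.hasSum.tendsto_sum_nat hlim]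
  exact hsum.hasSum

/-! ### The sequence of polylogarithms -/

/-- The polylogarithms: the sequence starts at `l₁` and each term is obtained from the preceding
one by inverting `Δ`. -/
def polylogSeq (l₁ : P.contLin) : ℕ → P.contLin
  -- Entry n is l_(n+1).
  | 0 => l₁
  | n + 1 => ⟨P.integral (n + 2) (polylogSeq l₁ n), integral_mem_contLin _ (polylogSeq l₁ n).2⟩

variable {P} in
lemma polylogSeq_agrees {l₁ : P.contLin} (h : P.AgreesWithPolylogSeries 1 l₁.1) (n : ℕ) :
    P.AgreesWithPolylogSeries (n + 1) (P.polylogSeq l₁ n).1 := by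
  induction n with
  | zero => exact h
  | succ n ih => exact integral_agrees ih

variable {P} in
lemma carlitzDelta_polylogSeq {l₁ : P.contLin} (h : P.AgreesWithPolylogSeries 1 l₁.1) (n : ℕ) :
    P.carlitzDelta (P.polylogSeq l₁ (n + 1)).1 = (P.polylogSeq l₁ n).1 :=
  carlitzDelta_integral (P.polylogSeq l₁ n).2 (polylogSeq_agrees h n)

variable {P} in
lemma polylogSeq_bounded {l₁ : P.contLin} (h : P.AgreesWithPolylogSeries 1 l₁.1)
    (hl₁ : P.SolvesLogEquation l₁.1) (n : ℕ) : ∃ M, ∀ t, ‖(P.polylogSeq l₁ n).1 t‖ ≤ M := by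
  induction n with
  | zero => exact exists_norm_le l₁.2 h (norm_carlitzDelta_le_one hl₁)
  | succ n ih =>
    obtain ⟨M, hM⟩ := ih
    exact exists_norm_le (P.polylogSeq l₁ (n + 1)).2 (polylogSeq_agrees h (n + 1))
      (by rwa [carlitzDelta_polylogSeq h])

variable {P} in
lemma exists_norm_coef_polylogSeq_le {l₁ : P.contLin} (h : P.AgreesWithPolylogSeries 1 l₁.1)
    (hl₁ : P.SolvesLogEquation l₁.1) (n : ℕ) :
    ∃ A : ℝ, 0 < A ∧ ∀ i, ‖P.coef (P.polylogSeq l₁ n).1 (i + P.δ)‖ ≤ A * P.r ^ P.q ^ i := by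
  obtain ⟨M, hM⟩ := polylogSeq_bounded h hl₁ n
  exact exists_norm_coef_add_le (P.polylogSeq l₁ n).2 (polylogSeq_agrees h n) hM

end FinPlace

end

theorem theorem2 {F : Type*} [Field F] [Fintype F] (P : FinPlace F)
    (l₁ : P.O →L[F] P.Ω)
    (hl₁ : P.SolvesLogEquation l₁)
    (hl₁' : P.AgreesWithPolylogSeries 1 l₁) :
    ∃ l : ℕ → (P.O →L[F] P.Ω), l 1 = l₁ ∧ ∀ n : ℕ, 2 ≤ n →
      -- `l n` is the unique solution
      (∀ u : P.O →L[F] P.Ω,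
        (P.carlitzDelta u = l (n - 1) ∧ P.AgreesWithPolylogSeries n u) ↔ u = l n) ∧
      -- its Carlitz expansion
      ∃ c : ℕ → P.Ω, P.HasCarlitzExpansion (l n) c ∧
        (∃ C : ℝ, 0 < C ∧ ∀ i : ℕ, P.δ < i →
          ‖c i‖ ≤ C * ((P.q : ℝ) ^ (P.δ * P.q ^ (i - P.δ)))⁻¹) ∧
        HasSum (fun i : ℕ =>
          (-1) ^ ((i + 1) + 1) * (c (i + 1) / algebraMap P.K P.Ω (P.L (i + 1)))) (c 0) := by
  let L₁ : P.contLin := ⟨l₁, P.coe_mem_contLin l₁⟩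
  -- Truncated subtraction also sets l 0 to l₁, a value that plays no role.
  refine ⟨fun n => P.contLinToCLM (P.polylogSeq L₁ (n - 1)), rfl, fun n hn => ?_⟩
  obtain ⟨m, rfl⟩ : ∃ m, n = m + 2 := ⟨n - 2, by omega⟩
  have hΔ := FinPlace.carlitzDelta_polylogSeq (l₁ := L₁) hl₁' m
  have hagr := FinPlace.polylogSeq_agrees (l₁ := L₁) hl₁' (m + 1)
  obtain ⟨A, hA, hdecay⟩ := FinPlace.exists_norm_coef_polylogSeq_le (l₁ := L₁) hl₁' hl₁ (m + 1)
  -- The formula for c_0 of l_n rests on the decay for l_(n+1), of which l_n is the Δ.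
  obtain ⟨B, hB, hdecay'⟩ := FinPlace.exists_norm_coef_polylogSeq_le (l₁ := L₁) hl₁' hl₁ (m + 2)
  refine ⟨fun u => ⟨fun ⟨h1, h2⟩ => ?_, ?_⟩, P.coef (P.polylogSeq L₁ (m + 1)).1, ?_,
    ⟨A, hA, fun i hi => ?_⟩, ?_⟩
  · exact DFunLike.coe_injective (FinPlace.eq_of_carlitzDelta_eq (P.coe_mem_contLin u)
      (P.polylogSeq L₁ (m + 1)).2 h2 hagr (h1.trans hΔ.symm))
  · rintro rfl
    exact ⟨hΔ, hagr⟩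
  · exact FinPlace.hasCarlitzExpansion (P.polylogSeq L₁ (m + 1)).2
      (FinPlace.tendsto_coef (FinPlace.tendsto_coef_mul_inv_pow hA hdecay))
  · have h := hdecay (i - P.δ)
    rwa [Nat.sub_add_cancel hi.le, FinPlace.r, inv_pow, ← pow_mul] at h
  · have h := FinPlace.hasSum_coef_div_L (FinPlace.tendsto_coef_mul_inv_pow hB hdecay')
    rwa [FinPlace.carlitzDelta_polylogSeq (l₁ := L₁) hl₁' (m + 1)] at h
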